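/- Let $d\in\mathbb N$, let $p>d$ be real and let $\mathcal X\subset\mathbb R^d$ be compact and convex. Then there is a constant $C=C_{d,p,\mathcal X}\ge 0$, depending only on $d$, $p$ and $\mathcal X$, with the following property. Let $\rho$ be a probability measure on $\mathcal X$, absolutely continuous with respect to the Lebesgue measure, whose density satisfies $0<m_\rho\le\rho\le M_\rho<+\infty$ almost everywhere on $\mathcal X$, and let $\mu$ be a probability measure on $\mathbb R^d$ with finite second moment. Let $\phi$ be the Brenier potential for the quadratic optimal transport from $\rho$ to $\mu$, that is, the lower semicontinuous convex function $\phi:\mathcal X\to(-\infty,+\infty]$ in $L^2(\mathcal X)$ with $\int_{\mathcal X}\phi\,\mathrm d\rho=0$ whose gradient $\nabla\phi$ is ($\rho$-almost everywhere) the optimal transport map from $\rho$ to $\mu$ for the cost $\|x-y\|^2$. Assume that $M_p<+\infty$ is such that $$M_p(\mu)=\int_{\mathbb R^d}\|y\|^p\,\mathrm d\mu(y)\le M_p .$$ Then $\phi$ is finite on $\mathcal X$ and Hölder continuous: for all $x,x'\in\mathcal X$, $$|\phi(x)-\phi(x')|\le C\left(\frac{M_p}{m_\rho}\right)^{1/p}\|x-x'\|^{1-\frac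 dp}.$$ In particular, there are $m_\phi,M_\phi\in\mathbb R$ such that $m_\phi\le\phi(x)\le M_\phi$ for all $x\in\mathcal X$ and $$M_\phi-m_\phi\le C\left(\frac{M_p}{m_\rho}\right)^{1/p}\operatorname{diam}(\mathcal X)^{1-\frac dp}.$$ -/

import Mathlib

open MeasureTheory
open scoped ENNReal NNReal

namespace OptimalTransport

/-- The Euclidean space `ℝ^d`. -/
abbrev Space (d : ℕ) : Type := EuclideanSpace ℝ (Fin d)

/-- The absolute moment `M_p(μ) = ∫ ‖y‖^p dμ(y)`, with values in `[0, ∞]`. -/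
noncomputable def moment {d : ℕ} (p : ℝ) (μ : Measure (Space d)) : ℝ≥0∞ :=
  ∫⁻ y, ‖y‖ₑ ^ p ∂μ

/-- `γ` is a transport plan between `ρ` and `μ`: its marginals are `ρ` and `μ`. -/
def IsTransportPlan {d : ℕ} (ρ μ : Measure (Space d)) (γ : Measure (Space d × Space d)) : Prop :=
  γ.map Prod.fst = ρ ∧ γ.map Prod.snd = μ

/-- The quadratic transport cost `∫ ‖x - y‖² dγ(x, y)` of a plan. -/
noncomputable def quadraticCost {d : ℕ} (γ : Measure (Space d × Space d)) : ℝ≥0∞ :=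
  ∫⁻ z, ‖z.1 - z.2‖ₑ ^ 2 ∂γ

/-- `γ` is an optimal transport plan between `ρ` and `μ` for the quadratic cost. -/
def IsOptimalPlan {d : ℕ} (ρ μ : Measure (Space d)) (γ : Measure (Space d × Space d)) : Prop :=
  IsTransportPlan ρ μ γ ∧ ∀ γ', IsTransportPlan ρ μ γ' → quadraticCost γ ≤ quadraticCost γ'

/-- `T` is an optimal transport map (Brenier map) from `ρ` to `μ`: the plan `(id, T)_# ρ` that it
induces is optimal. In particular `T_# ρ = μ`. -/
def IsBrenierMap {d : ℕ} (ρ μ : Measure (Space d)) (T : Space d → Space d) : Prop :=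
  AEMeasurable T ρ ∧ IsOptimalPlan ρ μ (ρ.map fun x => (x, T x))

/-- `ρ` is carried by `X` and has there a density with respect to Lebesgue measure with values
in `[m, M]` (almost everywhere). -/
def HasDensityBetween {d : ℕ} (ρ : Measure (Space d)) (X : Set (Space d)) (m M : ℝ) : Prop :=
  ∃ f : Space d → ℝ, Measurable f ∧
    (∀ᵐ x ∂(volume.restrict X), m ≤ f x ∧ f x ≤ M) ∧
    ρ = (volume.restrict X).withDensity fun x => ENNReal.ofReal (f x)

/-- `φ : X → (-∞, +∞]` is the Brenier potential from `ρ` to `μ`: a convex function in `L²(X)`,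
with zero mean against `ρ`, whose gradient is the Brenier map. A convex function in `L²(X)` is
determined by this only in the interior of `X`; its values on the boundary are those of
the lower semicontinuous (closed) representative, which may a priori be `+∞` there.
The values of `φ` outside `X` play no role. -/
structure IsBrenierPotential {d : ℕ} (X : Set (Space d)) (ρ μ : Measure (Space d))
    (φ : Space d → EReal) : Prop where
  ne_bot : ∀ x ∈ X, φ x ≠ ⊥
  /-- Convexity on `X`, through the epigraph. -/
  convex : Convex ℝ {q : Space d × ℝ | q.1 ∈ X ∧ φ q.1 ≤ (q.2 : EReal)}
  lowerSemicontinuousOn : LowerSemicontinuousOn φ X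
  ae_finite : ∀ᵐ x ∂(volume.restrict X), φ x ≠ ⊤
  memLp : MemLp (fun x => (φ x).toReal) 2 (volume.restrict X)
  gradient : ∃ T : Space d → Space d, IsBrenierMap ρ μ T ∧
    ∀ᵐ x ∂ρ, HasGradientAt (fun z => (φ z).toReal) (T x) x
  integral_eq_zero : ∫ x, (φ x).toReal ∂ρ = 0

end OptimalTransport

namespace OptimalTransport

/-! ### Tangent planes and midpoint convexity. -/

section ConvexPotential

variable {E : Type*} [NormedAddCommGroup E] [InnerProductSpace ℝ E] {X : Set E} {φ : E → EReal}

/-! This is Morrey's embedding for convex functions. The Brenier map `T = ∇φ` pushes `ρ` to `μ`, and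
`ρ ≥ m_ρ` on `X`, so `∫_X ‖T‖^p ≤ M_p / m_ρ =: A`.

In a ball of radius `s` in `X` centred at `c`, averaging gives a symmetric pair `c ± h` where `‖T‖ ≲
(A / s^d)^(1/p)`. Tangent planes at both points and convexity at their midpoint `c` bound `φ c - φ
y` by this slope times `s + ‖c - y‖` (`le_add_of_ball_subset`).

At a boundary point `x`, use points tending to `x` along a segment from an interior ball: by
convexity `X` contains balls around them of radius proportional to the distance left. Halving this
distance gives increments of order `τ^(1 - d/p)`, a geometric series since `p > d`. Lower
semicontinuity passes the bound to `x` itself (`le_add_rpow_norm_sub`); exchanging `x` and `y`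
finishes. -/

theorem le_of_convex_epigraph
    (hφ : Convex ℝ {q : E × ℝ | q.1 ∈ X ∧ φ q.1 ≤ (q.2 : EReal)})
    {x y : E} (hx : x ∈ X) (hy : y ∈ X) {a b : ℝ} (ha : φ x ≤ a) (hb : φ y ≤ b)
    {s t : ℝ} (hs : 0 ≤ s) (ht : 0 ≤ t) (hst : s + t = 1) :
    φ (s • x + t • y) ≤ ((s * a + t * b : ℝ) : EReal) :=
  (hφ (x := (x, a)) ⟨hx, ha⟩ (y := (y, b)) ⟨hy, hb⟩ hs ht hst).2

/-- A convex function lies above its tangent planes. -/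
theorem toReal_add_inner_le [CompleteSpace E] (hbot : ∀ x ∈ X, φ x ≠ ⊥) (hX : Convex ℝ X)
    (hφ : Convex ℝ {q : E × ℝ | q.1 ∈ X ∧ φ q.1 ≤ (q.2 : EReal)})
    {x y v : E} (hx : x ∈ X) (hy : y ∈ X) (hfin : φ x ≠ ⊤)
    (hgrad : HasGradientAt (fun z => (φ z).toReal) v x) {b : ℝ} (hb : φ y ≤ b) :
    (φ x).toReal + inner ℝ v (y - x) ≤ b := by
  have hline : HasDerivAt (fun t : ℝ => x + t • (y - x)) (y - x) 0 := by
    simpa using ((hasDerivAt_id (0 : ℝ)).smul_const (y - x)).const_add x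
  have hgrad' : HasFDerivAt (fun z => (φ z).toReal) (InnerProductSpace.toDual ℝ E v)
      (x + (0 : ℝ) • (y - x)) := by
    simpa using hgrad.hasFDerivAt
  have hder : HasDerivAt (fun t : ℝ => (φ (x + t • (y - x))).toReal) (inner ℝ v (y - x)) 0 := by
    simpa [Function.comp_def] using hgrad'.comp_hasDerivAt (0 : ℝ) hline
  have hlim := hder.tendsto_slope_zero_right
  have hle : inner ℝ v (y - x) ≤ b - (φ x).toReal := by
    -- Only right difference quotients are needed; by convexity each is at most `b - φ x`.
    refine le_of_tendsto hlim ?_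
    filter_upwards [Ioo_mem_nhdsGT (zero_lt_one' ℝ)] with t ht
    have hz : x + t • (y - x) = (1 - t) • x + t • y := by module
    have h1 : φ (x + t • (y - x)) ≤ (((1 - t) * (φ x).toReal + t * b : ℝ) : EReal) := by
      rw [hz]
      exact le_of_convex_epigraph hφ hx hy (EReal.le_coe_toReal hfin) hb
        (by linarith [ht.2]) ht.1.le (by ring)
    have hmem : x + t • (y - x) ∈ X := by
      rw [hz]
      exact hX hx hy (by linarith [ht.2]) ht.1.le (by ring)
    have h2 := EReal.toReal_le_toReal h1 (hbot _ hmem) (EReal.coe_ne_top _)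
    rw [EReal.toReal_coe] at h2
    simp only [zero_add, zero_smul, add_zero, smul_eq_mul]
    rw [inv_mul_le_iff₀ ht.1]
    linarith
  linarith

/-- The values of a convex function at the ends of a symmetric segment around `c` bound its
value at `c`. -/
theorem le_add_of_symmetric_gradient_bound [CompleteSpace E] (hbot : ∀ x ∈ X, φ x ≠ ⊥)
    (hX : Convex ℝ X) (hφ : Convex ℝ {q : E × ℝ | q.1 ∈ X ∧ φ q.1 ≤ (q.2 : EReal)})
    {T : E → E} {c h y : E} {s L b : ℝ} (hh : ‖h‖ ≤ s) (hy : y ∈ X) (hb : φ y ≤ b)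
    (hgood : ∀ z ∈ ({c + h, c - h} : Set E), z ∈ X ∧ φ z ≠ ⊤ ∧
      HasGradientAt (fun z => (φ z).toReal) (T z) z ∧ ‖T z‖ ≤ L) :
    φ c ≤ ((b + L * (s + ‖c - y‖) : ℝ) : EReal) := by
  have hend : ∀ z ∈ ({c + h, c - h} : Set E), φ z ≤ ((b + L * (s + ‖c - y‖) : ℝ) : EReal) := by
    intro z hz
    obtain ⟨hzX, hzt, hzg, hzL⟩ := hgood z hz
    have hdist : ‖y - z‖ ≤ s + ‖c - y‖ := by
      have hzc : ‖c - z‖ ≤ s := by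
        rcases hz with rfl | rfl <;> simpa using hh
      calc ‖y - z‖ = ‖(c - z) - (c - y)‖ := by congr 1; abel
        _ ≤ ‖c - z‖ + ‖c - y‖ := norm_sub_le _ _
        _ ≤ s + ‖c - y‖ := by gcongr
    have hin : -(L * (s + ‖c - y‖)) ≤ inner ℝ (T z) (y - z) := by
      refine neg_le_of_abs_le ((abs_real_inner_le_norm _ _).trans ?_)
      exact mul_le_mul hzL hdist (norm_nonneg _) ((norm_nonneg _).trans hzL)
    have := toReal_add_inner_le hbot hX hφ hzX hy hzt hzg hb
    rw [← EReal.coe_toReal hzt (hbot z hzX)]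
    exact EReal.coe_le_coe_iff.2 (by linarith)
  have := le_of_convex_epigraph hφ (hgood (c + h) (by simp)).1 (hgood (c - h) (by simp)).1
    (hend (c + h) (by simp)) (hend (c - h) (by simp)) (s := 1 / 2) (t := 1 / 2)
    (by norm_num) (by norm_num) (by norm_num)
  convert this using 2
  · module
  · ring

end ConvexPotential

/-! ### Good symmetric pairs in a ball. -/

section Averaging

variable {d : ℕ} {X : Set (Space d)}

/-- A nonnegative function on a ball is bounded by twice its mean value at both ends of some
diametral segment avoiding a given null set. -/
theorem exists_symmetric_le_average {g : Space d → ℝ≥0∞} {P : Space d → Prop}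
    {c : Space d} {s : ℝ} (hs : 0 < s) (hsub : Metric.ball c s ⊆ X)
    (hg : AEMeasurable g (volume.restrict X)) (hP : ∀ᵐ x ∂(volume.restrict X), P x) :
    ∃ h : Space d, ‖h‖ ≤ s ∧ ∀ z ∈ ({c + h, c - h} : Set (Space d)), z ∈ X ∧ P z ∧
      g z ≤ 2 * (∫⁻ x in X, g x) / volume (Metric.ball (0 : Space d) s) := by
  set B := Metric.ball (0 : Space d) s with hB
  have hmeasB : MeasurableSet B := Metric.isOpen_ball.measurableSet
  have hmp : MeasurePreserving (fun h : Space d => c + h) (volume.restrict B)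
      (volume.restrict (Metric.ball c s)) := by
    have := (measurePreserving_add_left (volume : Measure (Space d)) c).restrict_preimage
      (s := Metric.ball c s) Metric.isOpen_ball.measurableSet
    simpa [hB, preimage_add_ball] using this
  have hmm : MeasurePreserving (fun h : Space d => c - h) (volume.restrict B)
      (volume.restrict (Metric.ball c s)) := by
    have := (Measure.measurePreserving_sub_left (volume : Measure (Space d)) c).restrict_preimage
      (s := Metric.ball c s) Metric.isOpen_ball.measurableSet
    have hpre : (fun h : Space d => c - h) ⁻¹' Metric.ball c s = B := by
      ext h
      simp [hB, dist_eq_norm]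
    rwa [hpre] at this
  have hle : volume.restrict (Metric.ball c s) ≤ volume.restrict X :=
    Measure.restrict_mono hsub le_rfl
  have hg' : AEMeasurable g (volume.restrict (Metric.ball c s)) := hg.mono_measure hle
  have hgood : ∀ᵐ z ∂(volume.restrict (Metric.ball c s)), P z :=
    ae_mono hle hP
  have hae : ∀ᵐ h ∂(volume.restrict B), h ∈ B ∧ P (c + h) ∧ P (c - h) := by
    filter_upwards [ae_restrict_mem hmeasB, hmp.quasiMeasurePreserving.ae hgood,
      hmm.quasiMeasurePreserving.ae hgood] with h h1 h2 h3 using ⟨h1, h2, h3⟩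
  have hpos : 0 < volume B := Metric.measure_ball_pos _ _ hs
  have hfin : volume B ≠ ∞ := measure_ball_lt_top.ne
  have hmeas1 : AEMeasurable (fun h => g (c + h)) (volume.restrict B) :=
    hg'.comp_quasiMeasurePreserving hmp.quasiMeasurePreserving
  have hmeas2 : AEMeasurable (fun h => g (c - h)) (volume.restrict B) :=
    hg'.comp_quasiMeasurePreserving hmm.quasiMeasurePreserving
  have hI1 : ∫⁻ h in B, g (c + h) ≤ ∫⁻ x in X, g x := by
    rw [← lintegral_map' (f := g) (by rwa [hmp.map_eq]) hmp.aemeasurable, hmp.map_eq]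
    exact lintegral_mono' hle le_rfl
  have hI2 : ∫⁻ h in B, g (c - h) ≤ ∫⁻ x in X, g x := by
    rw [← lintegral_map' (f := g) (by rwa [hmm.map_eq]) hmm.aemeasurable, hmm.map_eq]
    exact lintegral_mono' hle le_rfl
  have : IsFiniteMeasure (volume.restrict B) := isFiniteMeasure_restrict.2 hfin
  -- Averaging the sum makes one `h` serve both ends, whence the factor 2.
  obtain ⟨h, hmem, hh⟩ := exists_notMem_null_le_laverage (μ := volume.restrict B)
    (f := fun h => g (c + h) + g (c - h))
    (by simpa using hpos.ne') (hmeas1.add hmeas2) (ae_iff.1 hae)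
  rw [Set.mem_ofPred_eq, not_not] at hmem
  obtain ⟨hhB, hP1, hP2⟩ := hmem
  have hav : g (c + h) + g (c - h) ≤ 2 * (∫⁻ x in X, g x) / volume B := by
    refine hh.trans ?_
    rw [laverage_eq, Measure.restrict_apply_univ, lintegral_add_left' hmeas1, two_mul]
    gcongr
  have hnorm : ‖h‖ < s := by simpa [hB] using hhB
  refine ⟨h, hnorm.le, ?_⟩
  rintro z (rfl | rfl)
  · exact ⟨hsub (by simpa using hnorm), hP1, le_self_add.trans hav⟩
  · exact ⟨hsub (by simpa [dist_eq_norm] using hnorm), hP2, le_add_self.trans hav⟩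

end Averaging

/-! ### Chaining up to the boundary. -/

section Hoelder

variable {d : ℕ} {p : ℝ} {X : Set (Space d)} {φ : Space d → EReal} {T : Space d → Space d}

/-- Upper bound for a convex function with `p`-integrable gradient at the centre of a ball. -/
theorem le_add_of_ball_subset (hp : 0 < p) (hbot : ∀ x ∈ X, φ x ≠ ⊥) (hX : Convex ℝ X)
    (hφ : Convex ℝ {q : Space d × ℝ | q.1 ∈ X ∧ φ q.1 ≤ (q.2 : EReal)})
    (hT : AEMeasurable T (volume.restrict X))
    (hgood : ∀ᵐ x ∂(volume.restrict X), φ x ≠ ⊤ ∧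
      HasGradientAt (fun z => (φ z).toReal) (T x) x)
    {A : ℝ} (hA : 0 ≤ A) (hTA : ∫⁻ x in X, ‖T x‖ₑ ^ p ≤ ENNReal.ofReal A)
    {c y : Space d} {s b : ℝ} (hs : 0 < s) (hsub : Metric.ball c s ⊆ X) (hy : y ∈ X)
    (hb : φ y ≤ b) :
    φ c ≤ ((b + (2 * A / volume.real (Metric.ball (0 : Space d) 1)) ^ (1 / p) * s ^ (-(d / p)) *
      (s + ‖c - y‖) : ℝ) : EReal) := by
  obtain ⟨h, hhs, hh⟩ := exists_symmetric_le_average hs hsub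
    (g := fun x => ‖T x‖ₑ ^ p) (hT.enorm.pow_const p) hgood
  refine le_add_of_symmetric_gradient_bound (T := T) hbot hX hφ hhs hy hb fun z hz => ?_
  obtain ⟨hzX, ⟨hzt, hzg⟩, hzT⟩ := hh z hz
  refine ⟨hzX, hzt, hzg, ?_⟩
  set ω := volume.real (Metric.ball (0 : Space d) 1) with hω
  have hωpos : 0 < ω := ENNReal.toReal_pos (Metric.measure_ball_pos _ _ one_pos).ne'
    measure_ball_lt_top.ne
  have hvol : volume (Metric.ball (0 : Space d) s) = ENNReal.ofReal (s ^ d * ω) := by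
    rw [Measure.addHaar_ball_of_pos _ _ hs, ENNReal.ofReal_mul (by positivity), hω,
      ofReal_measureReal measure_ball_lt_top.ne]
    simp
  have h1 : ‖T z‖ ^ p ≤ 2 * A / (s ^ d * ω) := by
    have h2 : ENNReal.ofReal (‖T z‖ ^ p) ≤ ENNReal.ofReal (2 * A / (s ^ d * ω)) := by
      rw [← ENNReal.ofReal_rpow_of_nonneg (norm_nonneg _) hp.le, ofReal_norm,
        ENNReal.ofReal_div_of_pos (by positivity), ENNReal.ofReal_mul zero_le_two, ← hvol]
      refine hzT.trans ?_
      rw [ENNReal.ofReal_ofNat]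
      gcongr
    exact (ENNReal.ofReal_le_ofReal_iff (by positivity)).1 h2
  have h3 : ‖T z‖ ≤ (2 * A / (s ^ d * ω)) ^ (1 / p) := by
    rw [one_div, Real.le_rpow_inv_iff_of_pos (norm_nonneg _) (by positivity) hp]
    exact h1
  refine h3.trans_eq ?_
  have h4 : 2 * A / (s ^ d * ω) = 2 * A / ω * (s ^ (d : ℝ))⁻¹ := by
    rw [Real.rpow_natCast]
    field_simp
  rw [h4, Real.mul_rpow (by positivity) (by positivity), ← Real.rpow_neg hs.le,
    ← Real.rpow_mul hs.le]
  congr 2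
  ring

/-- The one-sided form of Morrey's estimate for a convex function, valid up to the boundary. -/
theorem le_add_rpow_norm_sub (hp : (d : ℝ) < p) (hbot : ∀ x ∈ X, φ x ≠ ⊥) (hX : Convex ℝ X)
    (hφ : Convex ℝ {q : Space d × ℝ | q.1 ∈ X ∧ φ q.1 ≤ (q.2 : EReal)})
    (hlsc : LowerSemicontinuousOn φ X)
    (hT : AEMeasurable T (volume.restrict X))
    (hgood : ∀ᵐ x ∂(volume.restrict X), φ x ≠ ⊤ ∧
      HasGradientAt (fun z => (φ z).toReal) (T x) x)
    {A : ℝ} (hA : 0 ≤ A) (hTA : ∫⁻ x in X, ‖T x‖ₑ ^ p ≤ ENNReal.ofReal A)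
    {x₀ : Space d} {R D : ℝ} (hR : 0 < R) (hRD : R ≤ D) (hball : Metric.ball x₀ R ⊆ X)
    (hD : ∀ x ∈ X, ∀ y ∈ X, ‖x - y‖ ≤ D)
    {x y : Space d} (hx : x ∈ X) (hy : y ∈ X) {b : ℝ} (hb : φ y ≤ b) :
    φ x ≤ ((b + 3 * D * R ^ (-(d / p)) * (2 * A / volume.real (Metric.ball (0 : Space d) 1)) ^ (1 / p)
      / (1 - 2⁻¹ ^ (1 - d / p)) * (‖x - y‖ / D) ^ (1 - d / p) : ℝ) : EReal) := by
  have hp0 : 0 < p := lt_of_le_of_lt (Nat.cast_nonneg d) hp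
  have hDpos : 0 < D := hR.trans_le hRD
  set α : ℝ := 1 - d / p with hα
  have hαpos : 0 < α := by rw [hα, sub_pos, div_lt_one hp0]; exact hp
  set H := (2 * A / volume.real (Metric.ball (0 : Space d) 1)) ^ (1 / p) with hH
  have hH0 : 0 ≤ H := Real.rpow_nonneg (div_nonneg (by positivity) measureReal_nonneg) _
  set K := 3 * D * R ^ (-(d / p)) * H with hK
  have hK0 : 0 ≤ K := by positivity
  set q : ℝ := 2⁻¹ ^ α with hq
  have hq1 : q < 1 := Real.rpow_lt_one (by norm_num) (by norm_num) hαpos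
  have hq0 : 0 ≤ q := by positivity
  set t := ‖x - y‖ / D with ht
  rcases eq_or_ne x y with rfl | hne
  · refine hb.trans (EReal.coe_le_coe_iff.2 ?_)
    have : 0 ≤ K / (1 - q) * t ^ α :=
      mul_nonneg (div_nonneg hK0 (by linarith)) (Real.rpow_nonneg (by positivity) _)
    linarith
  have htpos : 0 < t := div_pos (norm_pos_iff.2 (sub_ne_zero.2 hne)) hDpos
  have ht1 : t ≤ 1 := (div_le_one hDpos).2 (hD x hx y hy)
  have htD : ‖x - y‖ = t * D := by rw [ht]; field_simp
  have hx₀ : x₀ ∈ X := hball (Metric.mem_ball_self hR)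
  set c : ℝ → Space d := fun τ => x + τ • (x₀ - x) with hc
  have hcX : ∀ τ ∈ Set.Ioc (0 : ℝ) 1, c τ ∈ X := fun τ hτ =>
    hX.add_smul_sub_mem hx hx₀ ⟨hτ.1.le, hτ.2⟩
  -- The homothety of centre `x` and ratio `τ` maps the ball at `x₀` onto this one.
  have hcball : ∀ τ ∈ Set.Ioc (0 : ℝ) 1, Metric.ball (c τ) (τ * R) ⊆ X := by
    intro τ hτ z hz
    have hw : x₀ + τ⁻¹ • (z - c τ) ∈ X := by
      apply hball
      rw [Metric.mem_ball, dist_eq_norm, add_sub_cancel_left, norm_smul, Real.norm_eq_abs,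
        abs_of_pos (inv_pos.2 hτ.1), inv_mul_lt_iff₀ hτ.1, ← dist_eq_norm]
      exact hz
    have := hX hx hw (sub_nonneg.2 hτ.2) hτ.1.le (by ring)
    convert this using 1
    rw [smul_add, smul_smul, mul_inv_cancel₀ hτ.1.ne', one_smul, hc]
    module
  have hstep : ∀ τ ∈ Set.Ioc (0 : ℝ) 1, ∀ w ∈ X, ∀ β : ℝ, φ w ≤ β → ‖c τ - w‖ ≤ 2 * (τ * D) →
      φ (c τ) ≤ ((β + K * τ ^ α : ℝ) : EReal) := by
    intro τ hτ w hw β hβ hdist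
    refine (le_add_of_ball_subset hp0 hbot hX hφ hT hgood hA hTA (mul_pos hτ.1 hR)
      (hcball τ hτ) hw hβ).trans (EReal.coe_le_coe_iff.2 ?_)
    rw [← hH]
    have h1 : τ * R + ‖c τ - w‖ ≤ 3 * (τ * D) := by
      have := mul_le_mul_of_nonneg_left hRD hτ.1.le
      linarith
    have h2 : H * (τ * R) ^ (-(d / p)) * (τ * R + ‖c τ - w‖) ≤
        H * (τ * R) ^ (-(d / p)) * (3 * (τ * D)) := by
      have := hτ.1
      gcongr
    have h3 : H * (τ * R) ^ (-(d / p)) * (3 * (τ * D)) = K * τ ^ α := by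
      rw [Real.mul_rpow hτ.1.le hR.le, hα, sub_eq_add_neg, Real.rpow_add hτ.1, Real.rpow_one, hK]
      ring
    linarith
  have hcx : ∀ τ : ℝ, 0 ≤ τ → ‖c τ - x‖ ≤ τ * D := by
    intro τ hτ
    rw [hc, add_sub_cancel_left, norm_smul, Real.norm_eq_abs, abs_of_nonneg hτ]
    exact mul_le_mul_of_nonneg_left (hD _ hx₀ _ hx) hτ
  -- The first scale is `t = ‖x - y‖ / D`, so that `y` is within `2 * (τ 0 * D)` of `c (τ 0)`.
  set τ : ℕ → ℝ := fun k => t * 2⁻¹ ^ k with hτdef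
  have hτ : ∀ k, τ k ∈ Set.Ioc (0 : ℝ) 1 := fun k =>
    ⟨by positivity, mul_le_one₀ ht1 (by positivity) (pow_le_one₀ (by norm_num) (by norm_num))⟩
  have hτα : ∀ k, τ k ^ α = t ^ α * q ^ k := by
    intro k
    rw [hτdef, Real.mul_rpow htpos.le (by positivity), hq, ← Real.rpow_natCast,
      ← Real.rpow_natCast, ← Real.rpow_mul (by norm_num), ← Real.rpow_mul (by norm_num), mul_comm α]
  have hq' : 1 - q ≠ 0 := by linarith
  -- Closed form of `K * t ^ α * (1 + q + ⋯ + q ^ k)`.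
  have hchain : ∀ k, φ (c (τ k)) ≤
      ((b + K / (1 - q) * t ^ α * (1 - q ^ (k + 1)) : ℝ) : EReal) := by
    intro k
    induction k with
    | zero =>
      have h0 : τ 0 = t := by simp [hτdef]
      have := hstep (τ 0) (hτ 0) y hy b hb (by
        calc ‖c (τ 0) - y‖ = ‖(c (τ 0) - x) + (x - y)‖ := by congr 1; abel
          _ ≤ ‖c (τ 0) - x‖ + ‖x - y‖ := norm_add_le _ _
          _ ≤ τ 0 * D + t * D := add_le_add (hcx _ (hτ 0).1.le) htD.le
          _ = 2 * (τ 0 * D) := by rw [h0]; ring)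
      refine this.trans_eq (congrArg _ ?_)
      rw [h0]
      field_simp
      ring
    | succ k ih =>
      have hhalf : τ k = 2 * τ (k + 1) := by simp only [hτdef, pow_succ]; ring
      have := hstep (τ (k + 1)) (hτ (k + 1)) _ (hcX _ (hτ k)) _ ih (by
        have h1 : c (τ (k + 1)) - c (τ k) = -(c (τ (k + 1)) - x) := by
          simp only [hc, hhalf]; module
        rw [h1, norm_neg]
        have h2 := hcx _ (hτ (k + 1)).1.le
        have h3 := mul_nonneg (hτ (k + 1)).1.le hDpos.le
        linarith)
      refine this.trans_eq (congrArg _ ?_)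
      rw [hτα]
      field_simp
      ring
  have hbound : ∀ k, φ (c (τ k)) ≤ ((b + K / (1 - q) * t ^ α : ℝ) : EReal) := by
    intro k
    refine (hchain k).trans (EReal.coe_le_coe_iff.2 ?_)
    have h1 : 0 ≤ K / (1 - q) * t ^ α :=
      mul_nonneg (div_nonneg hK0 (by linarith)) (Real.rpow_nonneg htpos.le _)
    have h2 : 0 ≤ q ^ (k + 1) := by positivity
    nlinarith [mul_nonneg h1 h2]
  have hlim : Filter.Tendsto (fun k => c (τ k)) Filter.atTop (nhdsWithin x X) := by
    refine tendsto_nhdsWithin_iff.2 ⟨?_, Filter.Eventually.of_forall fun k => hcX _ (hτ k)⟩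
    have h1 : Filter.Tendsto τ Filter.atTop (nhds 0) := by
      simpa [hτdef] using (tendsto_pow_atTop_nhds_zero_of_lt_one (r := (2⁻¹ : ℝ)) (by norm_num)
        (by norm_num)).const_mul t
    simpa using (h1.smul_const (x₀ - x)).const_add x
  -- Lower semicontinuity: a larger value at `x` would force larger values at some `c (τ k)`.
  by_contra! hcon
  obtain ⟨k, hk⟩ := (hlim.eventually (hlsc x hx _ hcon)).exists
  exact absurd (hbound k) (not_le.2 hk)

end Hoelder

/-! ### From the moment of `μ` to the Lebesgue `p`-norm of the gradient. -/

section Density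

variable {d : ℕ} {X : Set (Space d)} {ρ μ : Measure (Space d)} {m M : ℝ}

theorem HasDensityBetween.smul_restrict_le (h : HasDensityBetween ρ X m M) :
    ENNReal.ofReal m • volume.restrict X ≤ ρ := by
  obtain ⟨f, -, hf, rfl⟩ := h
  rw [← withDensity_const]
  exact withDensity_mono (hf.mono fun x hx => ENNReal.ofReal_le_ofReal hx.1)

theorem HasDensityBetween.restrict_absolutelyContinuous (h : HasDensityBetween ρ X m M)
    (hm : 0 < m) : volume.restrict X ≪ ρ :=
  (Measure.absolutelyContinuous_smul (ENNReal.ofReal_pos.2 hm).ne').trans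
    h.smul_restrict_le.absolutelyContinuous

theorem HasDensityBetween.volume_ne_zero [NeZero ρ] (h : HasDensityBetween ρ X m M) :
    volume X ≠ 0 := by
  obtain ⟨f, -, -, hρ⟩ := h
  intro h0
  refine NeZero.ne ρ ?_
  rw [hρ, Measure.restrict_eq_zero.2 h0, withDensity_zero_left]

theorem HasDensityBetween.lintegral_le (h : HasDensityBetween ρ X m M) (hm : 0 < m)
    (g : Space d → ℝ≥0∞) :
    ∫⁻ x in X, g x ≤ (∫⁻ x, g x ∂ρ) / ENNReal.ofReal m := by
  rw [ENNReal.le_div_iff_mul_le (.inl (ENNReal.ofReal_pos.2 hm).ne') (.inl ENNReal.ofReal_ne_top),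
    mul_comm, ← smul_eq_mul, ← lintegral_smul_measure]
  exact lintegral_mono' h.smul_restrict_le le_rfl

theorem IsBrenierMap.map_eq {T : Space d → Space d} (hT : IsBrenierMap ρ μ T) :
    ρ.map T = μ := by
  rw [← hT.2.1.2, AEMeasurable.map_map_of_aemeasurable measurable_snd.aemeasurable
    (aemeasurable_id'.prodMk hT.1)]
  rfl

theorem IsBrenierMap.lintegral_enorm_rpow {T : Space d → Space d} (hT : IsBrenierMap ρ μ T)
    (p : ℝ) : ∫⁻ x, ‖T x‖ₑ ^ p ∂ρ = moment p μ := by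
  rw [moment, ← hT.map_eq, lintegral_map' (by fun_prop) hT.1]

end Density

/-- Otherwise the affine span is a proper subspace, hence null. -/
theorem _root_.Convex.interior_nonempty_of_volume_ne_zero {d : ℕ} {X : Set (Space d)}
    (hX : Convex ℝ X) (h : volume X ≠ 0) : (interior X).Nonempty := by
  rw [hX.interior_nonempty_iff_affineSpan_eq_top]
  by_contra hne
  exact h (measure_mono_null (subset_affineSpan ℝ X) (Measure.addHaar_affineSubspace _ _ hne))

end OptimalTransport

theorem mainTheorem9 (d : ℕ) (p : ℝ) (hp : (d : ℝ) < p)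
    (X : Set (OptimalTransport.Space d)) (hXc : IsCompact X) (hXconv : Convex ℝ X) :
    ∃ C : ℝ, 0 ≤ C ∧
      ∀ (ρ : Measure (OptimalTransport.Space d)) (mρ Mρ : ℝ),
        IsProbabilityMeasure ρ → 0 < mρ →
        OptimalTransport.HasDensityBetween ρ X mρ Mρ →
      ∀ μ : Measure (OptimalTransport.Space d),
        IsProbabilityMeasure μ → OptimalTransport.moment 2 μ < ∞ →
      ∀ φ : OptimalTransport.Space d → EReal,
        OptimalTransport.IsBrenierPotential X ρ μ φ →
      ∀ Mp : ℝ≥0, OptimalTransport.moment p μ ≤ (Mp : ℝ≥0∞) →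
        (∀ x ∈ X, φ x ≠ ⊤ ∧ φ x ≠ ⊥) ∧
        (∀ x ∈ X, ∀ x' ∈ X,
          |(φ x).toReal - (φ x').toReal| ≤
            C * ((Mp : ℝ) / mρ) ^ (1 / p) * ‖x - x'‖ ^ (1 - (d : ℝ) / p)) ∧
        (∃ mφ Mφ : ℝ,
          (∀ x ∈ X, (mφ : EReal) ≤ φ x ∧ φ x ≤ (Mφ : EReal)) ∧
          Mφ - mφ ≤ C * ((Mp : ℝ) / mρ) ^ (1 / p) * Metric.diam X ^ (1 - (d : ℝ) / p)) := by
  have hp0 : 0 < p := lt_of_le_of_lt (Nat.cast_nonneg d) hp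
  have hα : 0 < 1 - (d : ℝ) / p := by rw [sub_pos, div_lt_one hp0]; exact hp
  by_cases hint : (interior X).Nonempty
  swap
  -- With empty interior `X` is null and carries no admissible `ρ`.
  · refine ⟨0, le_rfl, fun ρ mρ Mρ hρ _ hdens => absurd ?_ hint⟩
    exact hXconv.interior_nonempty_of_volume_ne_zero hdens.volume_ne_zero
  obtain ⟨x₀, hx₀⟩ := hint
  obtain ⟨R, hR, hball⟩ := Metric.isOpen_iff.1 isOpen_interior x₀ hx₀
  replace hball : Metric.ball x₀ R ⊆ X := hball.trans interior_subset
  -- Adding `R` keeps `D ≥ R > 0` even for `d = 0`, where the diameter vanishes.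
  set D := Metric.diam X + R with hDdef
  have hRD : R ≤ D := le_add_of_nonneg_left Metric.diam_nonneg
  have hDpos : 0 < D := hR.trans_le hRD
  have hdiam : ∀ x ∈ X, ∀ y ∈ X, ‖x - y‖ ≤ Metric.diam X := fun x hx y hy => by
    rw [← dist_eq_norm]
    exact Metric.dist_le_diam_of_mem hXc.isBounded hx hy
  have hD : ∀ x ∈ X, ∀ y ∈ X, ‖x - y‖ ≤ D := fun x hx y hy =>
    (hdiam x hx y hy).trans (le_add_of_nonneg_right hR.le)
  set ω := volume.real (Metric.ball (0 : OptimalTransport.Space d) 1) with hω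
  have hω0 : 0 ≤ ω := measureReal_nonneg
  set q : ℝ := 2⁻¹ ^ (1 - (d : ℝ) / p) with hq
  have hq1 : 0 < 1 - q := sub_pos.2 (Real.rpow_lt_one (by norm_num) (by norm_num) hα)
  set C := 3 * D * R ^ (-(d / p)) * (2 / ω) ^ (1 / p) / (1 - q) * (D ^ (1 - (d : ℝ) / p))⁻¹
    with hC
  have hC0 : 0 ≤ C := by positivity
  refine ⟨C, hC0, fun ρ mρ Mρ hρ hmρ hdens μ _ _ φ hφ Mp hMp => ?_⟩
  obtain ⟨T, hT, hgrad⟩ := hφ.gradient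
  have hac := hdens.restrict_absolutelyContinuous hmρ
  have hA : (0 : ℝ) ≤ Mp / mρ := by positivity
  have hTA : ∫⁻ x in X, ‖T x‖ₑ ^ p ≤ ENNReal.ofReal (Mp / mρ) := by
    refine (hdens.lintegral_le hmρ _).trans ?_
    rw [hT.lintegral_enorm_rpow, ENNReal.ofReal_div_of_pos hmρ, ENNReal.ofReal_coe_nnreal]
    gcongr
  have hgood := hφ.ae_finite.and (hac.ae_le hgrad)
  have key : ∀ x ∈ X, ∀ y ∈ X, ∀ b : ℝ, φ y ≤ b →
      φ x ≤ ((b + C * ((Mp : ℝ) / mρ) ^ (1 / p) * ‖x - y‖ ^ (1 - (d : ℝ) / p) : ℝ) : EReal) := by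
    intro x hx y hy b hb
    refine (OptimalTransport.le_add_rpow_norm_sub hp hφ.ne_bot hXconv hφ.convex
      hφ.lowerSemicontinuousOn (hT.1.mono_ac hac) hgood hA hTA hR hRD hball hD hx hy
      hb).trans_eq (congrArg _ ?_)
    rw [Real.div_rpow (norm_nonneg _) hDpos.le, ← hω, mul_div_right_comm 2,
      Real.mul_rpow (by positivity) hA, hC]
    ring
  -- One point of finiteness, found almost everywhere, spreads to all of `X` through `key`.
  have hfin : ∀ x ∈ X, φ x ≠ ⊤ := by
    have hne : volume.restrict X ≠ 0 := fun h =>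
      hdens.volume_ne_zero (Measure.restrict_eq_zero.1 h)
    have : (ae (volume.restrict X)).NeBot := ae_neBot.2 hne
    obtain ⟨y, hy, hyX⟩ := (hφ.ae_finite.and (ae_restrict_mem hXc.measurableSet)).exists
    intro x hx htop
    have := key x hx y hyX _ (EReal.le_coe_toReal hy)
    rw [htop, top_le_iff] at this
    exact EReal.coe_ne_top _ this
  have hone : ∀ x ∈ X, ∀ y ∈ X, (φ x).toReal ≤ (φ y).toReal +
      C * ((Mp : ℝ) / mρ) ^ (1 / p) * ‖x - y‖ ^ (1 - (d : ℝ) / p) := fun x hx y hy => by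
    have := EReal.toReal_le_toReal (key x hx y hy _ (EReal.le_coe_toReal (hfin y hy)))
      (hφ.ne_bot x hx) (EReal.coe_ne_top _)
    rwa [EReal.toReal_coe] at this
  refine ⟨fun x hx => ⟨hfin x hx, hφ.ne_bot x hx⟩, fun x hx y hy => ?_, ?_⟩
  · rw [abs_sub_le_iff]
    constructor
    · linarith [hone x hx y hy]
    · rw [norm_sub_rev]
      linarith [hone y hy x hx]
  · set B := C * ((Mp : ℝ) / mρ) ^ (1 / p) * Metric.diam X ^ (1 - (d : ℝ) / p) with hB
    have hosc : ∀ x ∈ X, ∀ y ∈ X, (φ x).toReal ≤ (φ y).toReal + B := fun x hx y hy => by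
      refine (hone x hx y hy).trans ?_
      have := hdiam x hx y hy
      rw [hB]
      gcongr
    have hx₀X : x₀ ∈ X := hball (Metric.mem_ball_self hR)
    set I := sInf ((fun x => (φ x).toReal) '' X) with hI
    have hIle : ∀ x ∈ X, I ≤ (φ x).toReal := fun x hx => by
      refine csInf_le ⟨(φ x₀).toReal - B, ?_⟩ (Set.mem_image_of_mem _ hx)
      rintro _ ⟨y, hy, rfl⟩
      exact sub_le_iff_le_add.2 (hosc x₀ hx₀X y hy)
    have hleI : ∀ x ∈ X, (φ x).toReal ≤ I + B := fun x hx => by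
      rw [← sub_le_iff_le_add]
      refine le_csInf ⟨_, Set.mem_image_of_mem _ hx₀X⟩ ?_
      rintro _ ⟨y, hy, rfl⟩
      exact sub_le_iff_le_add.2 (hosc x hx y hy)
    refine ⟨I, I + B, fun x hx => ?_, by simp⟩
    rw [← EReal.coe_toReal (hfin x hx) (hφ.ne_bot x hx)]
    exact ⟨EReal.coe_le_coe_iff.2 (hIle x hx), EReal.coe_le_coe_iff.2 (hleI x hx)⟩
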